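/- \textbf{Theorem (Lie--Poisson--Jacobi reduction).} Let $G$ be a finite-dimensional real Lie group with Lie algebra $\mathfrak g=T_eG$ (with the bracket of left-invariant vector fields), and let $\mathcal L_g$ denote left translation by $g$. On $T^*G\times\mathbb R$ consider the canonical contact form $\eta=dz-\theta$, where $\theta$ is the tautological $1$-form of $T^*G$ and $z$ is the coordinate of $\mathbb R$; let $\mathcal R$ be its Reeb vector field ($\iota_{\mathcal R}d\eta=0$, $\eta(\mathcal R)=1$), let $\flat(v)=\iota_v d\eta+\eta(v)\eta$, and for a smooth function $H$ let $X_H$ be its contact Hamiltonian vector field, defined by $\flat(X_H)=dH-(H+\mathcal R(H))\,\eta$. The group $G$ acts on $T^*G\times\mathbb R$ by $g\cdot(\alpha_k,z)=(\alpha_k\circ T_{gk}\mathcal L_{g^{-1}},z)$ for $\alpha_k\in T_k^*G$. Let $$\hat J:T^*G\times\mathbb R\to\mathfrak g^*\times\mathbb R,\qquad \hat J(\alpha_g,z)=(\alpha_g\circ T_e\mathcal L_g,\,z),\quad \alpha_g\in T_g^*G .$$ On $\mathfrak g^*\times\mathbb R$ consider the Lie--Poisson--Jacobi structure $(\Lambda,E)$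 given by $E=-\partial/\partial z$ and $$\Lambda(\mu,z)(df,dk)=\Big\langle\mu,\Big[\frac{\delta f}{\delta\mu},\frac{\delta k}{\delta\mu}\Big]\Big\rangle+\Big\langle\mu,\frac{\delta f}{\delta\mu}\Big\rangle\frac{\partial k}{\partial z}-\Big\langle\mu,\frac{\delta k}{\delta\mu}\Big\rangle\frac{\partial f}{\partial z},$$ where $\delta f/\delta\mu\in\mathfrak g$ is the partial derivative of $f$ in the direction of $\mathfrak g^*$, regarded as an element of $\mathfrak g^{**}=\mathfrak g$. The Hamiltonian vector field of a smooth function $h$ is $X_h=\Lambda(dh,\cdot)+hE$. For a vector field $X$, let $\phi_t^X$ be the time-$t$ map of its maximal flow, a partially defined map: $\phi^X_t(p)$ is defined if and only if there is an integral curve of $X$ starting at $p$ on an open interval containing $0$ and $t$. Let $H:T^*G\times\mathbb R\to\mathbb R$ be a smooth $G$-invariant function, and let $h=H|_{\mathfrak g^*\times\mathbb R}$ be its restriction to $T_e^*G\times\mathbb R=\mathfrak g^*\times\mathbb R$. Then $h$ is smooth and $$H=h\circ\hat J .$$ Moreover, the vector fields $X_H$ and $X_h$ are $\hat J$-related, that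 is, $T\hat J\circ X_H=X_h\circ\hat J$, and their flows satisfy $$\hat J\circ\phi_t^{X_H}=\phi_t^{X_h}\circ\hat J\qquad\text{for all } t\in\mathbb R,$$ as an equality of partially defined maps (one side is defined at a point if and only if the other one is). -/

import Mathlib

open Bundle Set
open scoped Manifold ContDiff

noncomputable section

/-! ### Contact Hamiltonian vector fields -/

section Contact

variable {E : Type*} [NormedAddCommGroup E] [NormedSpace ℝ E]
  {K : Type*} [TopologicalSpace K] (I : ModelWithCorners ℝ E K)
  {M : Type*} [TopologicalSpace M] [ChartedSpace K M]

/-- The exterior derivative of a 1-form `η` on a manifold. In the chart `φ` around `p`, the form is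
`σ = (φ⁻¹)^* η`, and `dη_p (u, v) = (D σ · u) v - (D σ · v) u` (the derivative being taken at `φ p`,
the vectors `u, v` being read in the chart). -/
def extDerivOneForm (η : (p : M) → TangentSpace I p →L[ℝ] ℝ) (p : M) :
    TangentSpace I p →L[ℝ] TangentSpace I p →L[ℝ] ℝ :=
  let φ := extChartAt I p
  let σ : E → E →L[ℝ] ℝ := fun y =>
    (η (φ.symm y)).comp (mfderivWithin 𝓘(ℝ, E) I φ.symm (range I) y)
  let A : E →L[ℝ] E →L[ℝ] ℝ := fderivWithin ℝ σ (range I) (φ p)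
  let D : E →L[ℝ] E := mfderiv I 𝓘(ℝ, E) φ p
  let B : E →L[ℝ] E →L[ℝ] ℝ := (A - A.flip).bilinearComp D D
  B

/-- The map `♭ : TM → T^*M`, `♭ v = ι_v dη + η(v) η` of a contact form `η`. -/
def contactFlat (η : (p : M) → TangentSpace I p →L[ℝ] ℝ) (p : M) (v : TangentSpace I p) :
    TangentSpace I p →L[ℝ] ℝ :=
  extDerivOneForm I η p v + η p v • η p

/-- The Reeb vector field of a contact form `η`: at each point, the unique vector `r` with
`ι_r dη = 0` and `η(r) = 1`. -/
def reebField (η : (p : M) → TangentSpace I p →L[ℝ] ℝ) (p : M) : TangentSpace I p :=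
  Classical.epsilon fun r : TangentSpace I p => extDerivOneForm I η p r = 0 ∧ η p r = 1

/-- The contact Hamiltonian vector field of `f` for a contact form `η` with Reeb field `R`: at each
point, the unique vector `X_f` with `♭ X_f = df - (f + R f) η`. -/
def contactHamiltonianField (η : (p : M) → TangentSpace I p →L[ℝ] ℝ) (f : M → ℝ) (p : M) :
    TangentSpace I p :=
  let df : TangentSpace I p →L[ℝ] ℝ := mfderiv I 𝓘(ℝ, ℝ) f p
  Classical.epsilon fun X : TangentSpace I p =>
    contactFlat I η p X = df - (f p + df (reebField I η p)) • η p

end Contact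

/-! ### Flows and related vector fields -/

section Flow

variable {E : Type*} [NormedAddCommGroup E] [NormedSpace ℝ E]
  {K : Type*} [TopologicalSpace K] {I : ModelWithCorners ℝ E K}
  {M : Type*} [TopologicalSpace M] [ChartedSpace K M]
  {E' : Type*} [NormedAddCommGroup E'] [NormedSpace ℝ E']
  {K' : Type*} [TopologicalSpace K'] {I' : ModelWithCorners ℝ E' K'}
  {N : Type*} [TopologicalSpace N] [ChartedSpace K' N]

/-- `γ` is an integral curve of `X` starting at `p`, on an open interval containing `0` and `t`. -/
def IsFlowCurve (X : (p : M) → TangentSpace I p) (t : ℝ) (p : M) (γ : ℝ → M) : Prop :=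
  ∃ a b : ℝ, 0 ∈ Ioo a b ∧ t ∈ Ioo a b ∧ γ 0 = p ∧ IsMIntegralCurveOn γ X (Ioo a b)

/-- The time-`t` map `φ_t` of the (maximal) flow of the vector field `X`, as a partially defined
map: `φ_t(p)` is defined iff some integral curve starting at `p` exists up to time `t`, and its
value is then the value at `t` of such a curve (for a smooth field on a Hausdorff manifold without
boundary, it does not depend on the curve). -/
def flow (X : (p : M) → TangentSpace I p) (t : ℝ) (p : M) : Part M where
  Dom := ∃ γ : ℝ → M, IsFlowCurve X t p γ
  get h := Classical.choose h t

/-- The vector fields `X` on `M` and `Y` on `N` are `F`-related: `T F ∘ X = Y ∘ F`. -/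
def FieldsRelated (F : M → N) (X : (p : M) → TangentSpace I p) (Y : (q : N) → TangentSpace I' q) :
    Prop :=
  ∀ p : M, MDifferentiableAt I I' F p ∧ mfderiv I I' F p (X p) = Y (F p)

end Flow

/-! ### The contact manifold `T^*Q × ℝ` -/

section Cotangent

variable (E : Type*) [NormedAddCommGroup E] [NormedSpace ℝ E]
  (Q : Type*) [TopologicalSpace Q] [ChartedSpace E Q] [IsManifold 𝓘(ℝ, E) ∞ Q]

/-- The cotangent bundle `T^*Q`, with the topology and smooth structure of the bundle of
continuous linear maps from `TQ` to the trivial line bundle. Its elements are pairs `⟨q, α⟩` with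
`α ∈ T_q^*Q`. -/
abbrev CotangentBundle : Type _ :=
  TotalSpace (E →L[ℝ] ℝ) (fun q : Q => TangentSpace 𝓘(ℝ, E) q →L[ℝ] ℝ)

/-- The model with corners of `T^*Q`. -/
abbrev cotangentModel : ModelWithCorners ℝ (E × (E →L[ℝ] ℝ)) (ModelProd E (E →L[ℝ] ℝ)) :=
  𝓘(ℝ, E).prod 𝓘(ℝ, E →L[ℝ] ℝ)

/-- The model with corners of `T^*Q × ℝ`. -/
abbrev extCotangentModel : ModelWithCorners ℝ ((E × (E →L[ℝ] ℝ)) × ℝ)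
    (ModelProd (ModelProd E (E →L[ℝ] ℝ)) ℝ) :=
  (cotangentModel E).prod 𝓘(ℝ, ℝ)

variable {Q}

/-- The tautological 1-form `θ` of `T^*Q`: `θ_α (v) = α (T π v)`. -/
def tautologicalForm (α : CotangentBundle E Q) : TangentSpace (cotangentModel E) α →L[ℝ] ℝ :=
  α.2.comp (mfderiv (cotangentModel E) 𝓘(ℝ, E)
    (fun β : CotangentBundle E Q => β.proj) α)

/-- The canonical contact form `η = dz - θ` of `T^*Q × ℝ`. -/
def canonicalContactForm (p : CotangentBundle E Q × ℝ) :
    TangentSpace (extCotangentModel E) p →L[ℝ] ℝ :=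
  let dz : TangentSpace (extCotangentModel E) p →L[ℝ] ℝ :=
    mfderiv (extCotangentModel E) 𝓘(ℝ, ℝ) (fun x : CotangentBundle E Q × ℝ => x.2) p
  dz - (tautologicalForm E p.1).comp (mfderiv (extCotangentModel E) (cotangentModel E)
    (fun x : CotangentBundle E Q × ℝ => x.1) p)

end Cotangent

/-! ### Hamiltonian vector fields of Jacobi structures on a vector space -/

section Jacobi

variable {V : Type*} [NormedAddCommGroup V] [NormedSpace ℝ V]

/-- The vector of a finite dimensional space `V` that corresponds to the element `Φ` of the bidual
`V^{**} = V`: the unique `v` with `β v = Φ β` for all `β ∈ V^*`. -/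
def bidualVector (Φ : (V →L[ℝ] ℝ) → ℝ) : V :=
  Classical.epsilon fun v : V => ∀ β : V →L[ℝ] ℝ, β v = Φ β

/-- For a bivector field `Λ` on `V` and a covector `α` at `x`, the vector `♯_Λ α = Λ(α, ·)`. -/
def jacobiSharp (Λ : V → (V →L[ℝ] ℝ) → (V →L[ℝ] ℝ) → ℝ) (x : V) (α : V →L[ℝ] ℝ) : V :=
  bidualVector (Λ x α)

/-- The Hamiltonian vector field `X_f = ♯_Λ (df) + f R` of `f` for a Jacobi structure `(Λ, R)`
on the vector space `V`. -/
def jacobiHamiltonianField (Λ : V → (V →L[ℝ] ℝ) → (V →L[ℝ] ℝ) → ℝ) (R : V → V) (f : V → ℝ)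
    (x : V) : TangentSpace 𝓘(ℝ, V) x :=
  (jacobiSharp Λ x (fderiv ℝ f x) + f x • R x : V)

end Jacobi

/-! ### Lie groups -/

section LieGroup

variable (E : Type*) [NormedAddCommGroup E] [NormedSpace ℝ E]
  (G : Type*) [TopologicalSpace G] [ChartedSpace E G] [Group G]

/-- The dual `𝔤^*` of the Lie algebra `𝔤 = T_1 G`. The type `GroupLieAlgebra 𝓘(ℝ, E) G` of
elements of `𝔤` unfolds to `E`; the dual is written through `E` in order to carry the norm, hence
the smooth structure, of a finite dimensional vector space. -/
abbrev DualLieAlgebra (_G : Type*) : Type _ := E →L[ℝ] ℝ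

/-- The first component `ξ` of a covector `α = (ξ, a) ∈ (𝔤^* × ℝ)^* = 𝔤 × ℝ`. For `α = df` it is the
functional derivative `δf/δμ`. -/
def lieAlgebraPart (α : DualLieAlgebra E G × ℝ →L[ℝ] ℝ) : GroupLieAlgebra 𝓘(ℝ, E) G :=
  bidualVector (V := E) fun ν : E →L[ℝ] ℝ => α (ν, 0)

/-- The second component `a` of a covector `α = (ξ, a) ∈ (𝔤^* × ℝ)^* = 𝔤 × ℝ`. For `α = df` it is the
partial derivative `∂f/∂z`. -/
def scalarPart (α : DualLieAlgebra E G × ℝ →L[ℝ] ℝ) : ℝ :=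
  α (0, 1)

/-- The bivector field of the Lie-Poisson-Jacobi structure on `𝔤^* × ℝ`:
`Λ(μ, z)(α, β) = ⟨μ, [ξ, ξ']⟩ + ⟨μ, ξ⟩ b - ⟨μ, ξ'⟩ a`, where `α = (ξ, a)` and `β = (ξ', b)`. -/
def liePoissonJacobiBivector (x : DualLieAlgebra E G × ℝ)
    (α β : DualLieAlgebra E G × ℝ →L[ℝ] ℝ) : ℝ :=
  let bracket : GroupLieAlgebra 𝓘(ℝ, E) G := ⁅lieAlgebraPart E G α, lieAlgebraPart E G β⁆
  x.1 bracket
    + x.1 (lieAlgebraPart E G α) * scalarPart E G β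
    - x.1 (lieAlgebraPart E G β) * scalarPart E G α

/-- The vector field `-∂/∂z` of the Lie-Poisson-Jacobi structure on `𝔤^* × ℝ`. -/
def liePoissonJacobiVector (_x : DualLieAlgebra E G × ℝ) : DualLieAlgebra E G × ℝ :=
  (0, -1)

/-- The Hamiltonian vector field of `h` for the Lie-Poisson-Jacobi structure on `𝔤^* × ℝ`. -/
def liePoissonJacobiField (h : DualLieAlgebra E G × ℝ → ℝ) (x : DualLieAlgebra E G × ℝ) :
    TangentSpace 𝓘(ℝ, DualLieAlgebra E G × ℝ) x :=
  jacobiHamiltonianField (liePoissonJacobiBivector E G) (liePoissonJacobiVector E G) h x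

variable {G} [LieGroup 𝓘(ℝ, E) ∞ G]

/-- The cotangent lift of left translations, acting on `T^*G × ℝ`:
`g · (α_k, z) = (α_k ∘ T_{gk} L_{g⁻¹}, z)`, an element of `T_{gk}^*G × ℝ`. -/
def cotangentLiftAction (g : G) (p : CotangentBundle E G × ℝ) : CotangentBundle E G × ℝ :=
  let k : G := p.1.proj
  let L : E →L[ℝ] E := mfderiv 𝓘(ℝ, E) 𝓘(ℝ, E) (fun x : G => g⁻¹ * x) (g * k)
  let α : E →L[ℝ] ℝ := p.1.2
  (⟨g * k, (α.comp L : E →L[ℝ] ℝ)⟩, p.2)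

/-- The momentum map `J : T^*G → 𝔤^*`, `J(α_g) = α_g ∘ T_1 L_g`. -/
def momentumMap (α : CotangentBundle E G) : DualLieAlgebra E G :=
  α.2.comp (mfderiv 𝓘(ℝ, E) 𝓘(ℝ, E) (fun x : G => α.proj * x) 1)

/-- The map `Ĵ(α, z) = (J(α), z)`. -/
def momentumMapHat (p : CotangentBundle E G × ℝ) : DualLieAlgebra E G × ℝ :=
  (momentumMap E p.1, p.2)

/-- The restriction of a function on `T^*G × ℝ` to `𝔤^* × ℝ = T_1^*G × ℝ`. -/
def restrictToIdentity (H : CotangentBundle E G × ℝ → ℝ) (x : DualLieAlgebra E G × ℝ) : ℝ :=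
  H (⟨(1 : G), x.1⟩, x.2)

end LieGroup

end

/-!
Left translations trivialize `T^*G × ℝ ≃ G × (𝔤^* × ℝ)`, and `Ĵ` is the projection to the second
factor, so an invariant `H` is `h ∘ Ĵ`. In the coordinates `((x, ξ), z)` given by a chart, where
`η = dz - ξ dx`, the field of `h ∘ Ĵ` is explicit: writing `δ = δh/δμ`, its base component at a
point over `g` is the left translate `g · δ`, and `Ĵ` maps it to the field of `h` because the
commutator of the derivatives of the left invariant frame is the Lie bracket.

Relatedness sends the flow curves of `X_H` to flow curves of `X_h`. Conversely, a flow curve `c` of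
`X_h` is lifted by solving the reconstruction equation `k' = k · δh/δμ(c)` in `G`: local solutions
are translated to the left so that they fit together, hence they live as long as `c`, and the
point over `k` with `Ĵ = c` follows `X_H` because a tangent vector of `T^*G × ℝ` is determined by
its base component and its image under `Ĵ`.
-/

noncomputable section

section Flow

variable {E : Type*} [NormedAddCommGroup E] [NormedSpace ℝ E]
  {K : Type*} [TopologicalSpace K] {I : ModelWithCorners ℝ E K}
  {M : Type*} [TopologicalSpace M] [ChartedSpace K M]
  {E' : Type*} [NormedAddCommGroup E'] [NormedSpace ℝ E']
  {K' : Type*} [TopologicalSpace K'] {I' : ModelWithCorners ℝ E' K'}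
  {N : Type*} [TopologicalSpace N] [ChartedSpace K' N]

theorem FieldsRelated.isFlowCurve_comp {F : M → N} {X : (p : M) → TangentSpace I p}
    {Y : (q : N) → TangentSpace I' q} (hXY : FieldsRelated F X Y) {t : ℝ} {p : M} {γ : ℝ → M}
    (hγ : IsFlowCurve X t p γ) : IsFlowCurve Y t (F p) (F ∘ γ) := by
  obtain ⟨a, b, h0, ht, hp, hγ⟩ := hγ
  refine ⟨a, b, h0, ht, congrArg F hp, fun s hs => ?_⟩
  obtain ⟨hF, hX⟩ := hXY (γ s)
  refine (hF.hasMFDerivAt.comp_hasMFDerivWithinAt s (hγ s hs)).congr_mfderiv ?_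
  refine ContinuousLinearMap.ext_ring ?_
  change mfderiv I I' F (γ s) ((1 : ℝ) • X (γ s)) = (1 : ℝ) • Y (F (γ s))
  rw [one_smul, one_smul, hX]

theorem IsFlowCurve.apply_eq [IsManifold I' 1 N] [BoundarylessManifold I' N] [CompleteSpace E']
    [T2Space N] {Y : (q : N) → TangentSpace I' q}
    (hY : ContMDiff I' I'.tangent 1 fun q => (⟨q, Y q⟩ : TangentBundle I' N)) {t : ℝ} {q : N}
    {c c' : ℝ → N} (hc : IsFlowCurve Y t q c) (hc' : IsFlowCurve Y t q c') : c t = c' t := by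
  obtain ⟨a, b, h0, ht, hq, hc⟩ := hc
  obtain ⟨a', b', h0', ht', hq', hc'⟩ := hc'
  have hinter : Ioo (a ⊔ a') (b ⊓ b') = Ioo a b ∩ Ioo a' b' := Ioo_inter_Ioo.symm
  exact isMIntegralCurveOn_Ioo_eqOn_of_contMDiff_boundaryless (hinter ▸ ⟨h0, h0'⟩) hY
    (hc.mono (hinter ▸ inter_subset_left)) (hc'.mono (hinter ▸ inter_subset_right))
    (hq.trans hq'.symm) (hinter ▸ ⟨ht, ht'⟩)

theorem FieldsRelated.map_flow_eq [IsManifold I' 1 N] [BoundarylessManifold I' N]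
    [CompleteSpace E'] [T2Space N] {F : M → N} {X : (p : M) → TangentSpace I p}
    {Y : (q : N) → TangentSpace I' q} (hXY : FieldsRelated F X Y)
    (hY : ContMDiff I' I'.tangent 1 fun q => (⟨q, Y q⟩ : TangentBundle I' N)) {t : ℝ} {p : M}
    (hlift : ∀ c, IsFlowCurve Y t (F p) c → ∃ γ, IsFlowCurve X t p γ) :
    (flow X t p).map F = flow Y t (F p) := by
  refine Part.ext' ⟨fun ⟨_, hγ⟩ => ⟨_, hXY.isFlowCurve_comp hγ⟩, fun ⟨c, hc⟩ => hlift c hc⟩ ?_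
  intro hX hY'
  exact (hXY.isFlowCurve_comp hX.choose_spec).apply_eq hY hY'.choose_spec

end Flow

section Contact

variable {E : Type*} [NormedAddCommGroup E] [NormedSpace ℝ E]
  {K : Type*} [TopologicalSpace K] {I : ModelWithCorners ℝ E K}
  {M : Type*} [TopologicalSpace M] [ChartedSpace K M]

theorem mdifferentiableAt_extChartAt_symm [I.Boundaryless] [IsManifold I 1 M] {p : M} {y : E}
    (hy : y ∈ (extChartAt I p).target) :
    MDifferentiableAt 𝓘(ℝ, E) I (extChartAt I p).symm y := by
  rw [← mdifferentiableWithinAt_univ, ← I.range_eq_univ]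
  exact mdifferentiableWithinAt_extChartAt_symm hy

theorem extDerivOneForm_apply_of_hasFDerivAt [I.Boundaryless] [IsManifold I 1 M]
    (η : (p : M) → TangentSpace I p →L[ℝ] ℝ) (p : M)
    {σ : E → E →L[ℝ] ℝ} {A : E →L[ℝ] E →L[ℝ] ℝ}
    (hσ : ∀ y ∈ (extChartAt I p).target, (η ((extChartAt I p).symm y)).comp
      (mfderiv 𝓘(ℝ, E) I (extChartAt I p).symm y) = σ y)
    (hA : HasFDerivAt σ A (extChartAt I p p)) (u v : E) :
    extDerivOneForm I η p u v = A u v - A v u := by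
  have hfderiv : fderivWithin ℝ (fun y => (η ((extChartAt I p).symm y)).comp
      (mfderivWithin 𝓘(ℝ, E) I (extChartAt I p).symm (range I) y) : E → E →L[ℝ] ℝ)
      (range I) (extChartAt I p p) = A := by
    rw [I.range_eq_univ, fderivWithin_univ]
    refine (hA.congr_of_eventuallyEq ?_).fderiv
    filter_upwards [extChartAt_target_mem_nhds p] with y hy
    rw [← hσ y hy, mfderivWithin_univ]
    rfl
  have hchart : mfderiv I 𝓘(ℝ, E) (extChartAt I p) p = ContinuousLinearMap.id ℝ E :=
    mfderiv_extChartAt_self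
  have hbilin {B : E →L[ℝ] E →L[ℝ] ℝ} {D : E →L[ℝ] E} (hB : B = A)
      (hD : D = ContinuousLinearMap.id ℝ E) :
      (B - B.flip).bilinearComp D D u v = A u v - A v u := by
    subst hB hD
    rfl
  exact hbilin hfderiv hchart

variable {η : (p : M) → TangentSpace I p →L[ℝ] ℝ} {p : M}

theorem reebField_eq_of_injective (hη : Function.Injective (contactFlat I η p))
    {r : TangentSpace I p} (hr : extDerivOneForm I η p r = 0) (hηr : η p r = 1) :
    reebField I η p = r := by
  obtain ⟨hr', hηr'⟩ : extDerivOneForm I η p (reebField I η p) = 0 ∧ η p (reebField I η p) = 1 :=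
    Classical.epsilon_spec
      (p := fun r : TangentSpace I p => extDerivOneForm I η p r = 0 ∧ η p r = 1) ⟨r, hr, hηr⟩
  exact hη (by rw [contactFlat, contactFlat, hr, hr', hηr, hηr'])

theorem contactHamiltonianField_eq_of_injective (hη : Function.Injective (contactFlat I η p))
    {f : M → ℝ} {df : TangentSpace I p →L[ℝ] ℝ} (hf : HasMFDerivAt I 𝓘(ℝ, ℝ) f p df)
    {X : TangentSpace I p}
    (hX : contactFlat I η p X = df - (f p + df (reebField I η p)) • η p) :
    contactHamiltonianField I η f p = X := by
  rw [← hf.mfderiv] at hX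
  let df' : TangentSpace I p →L[ℝ] ℝ := mfderiv I 𝓘(ℝ, ℝ) f p
  have hfield : contactFlat I η p (contactHamiltonianField I η f p) =
      df' - (f p + df' (reebField I η p)) • η p :=
    Classical.epsilon_spec (p := fun X : TangentSpace I p =>
      contactFlat I η p X = df' - (f p + df' (reebField I η p)) • η p) ⟨X, hX⟩
  exact hη (hfield.trans hX.symm)

end Contact

section CotangentCoordinates

/-- The vector space in which the coordinates `((x, ξ), z)` of `T^*Q × ℝ` take their values. It is
also the type to which the tangent spaces of `T^*Q × ℝ` unfold. -/
abbrev ExtCotangentCoord (E : Type*) [NormedAddCommGroup E] [NormedSpace ℝ E] : Type _ :=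
  (E × (E →L[ℝ] ℝ)) × ℝ

variable {E : Type*} [NormedAddCommGroup E] [NormedSpace ℝ E]

/-- The linear map `((x, ξ), z) ↦ x`, which is the derivative of the projection `T^*Q × ℝ → Q` in
coordinates. -/
def baseProj : ExtCotangentCoord E →L[ℝ] E :=
  (ContinuousLinearMap.fst ℝ E (E →L[ℝ] ℝ)).comp (ContinuousLinearMap.fst ℝ _ ℝ)

/-- The linear map `((x, ξ), z) ↦ ξ`. -/
def fiberProj : ExtCotangentCoord E →L[ℝ] E →L[ℝ] ℝ :=
  (ContinuousLinearMap.snd ℝ E (E →L[ℝ] ℝ)).comp (ContinuousLinearMap.fst ℝ _ ℝ)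

variable {Q : Type*} [TopologicalSpace Q] [ChartedSpace E Q] [IsManifold 𝓘(ℝ, E) ∞ Q]

/-- The covector of an element of the cotangent bundle, as a linear form on the model space. -/
def covector (q : CotangentBundle E Q) : E →L[ℝ] ℝ := q.2

/-- The derivative of the inverse of the chart around `q`, taken at the coordinates of `x`. -/
def chartSymmDeriv (q x : Q) : E →L[ℝ] E :=
  (trivializationAt E (TangentSpace 𝓘(ℝ, E)) q).symmL ℝ x

theorem hasMFDerivAt_extChartAt_symm {q x : Q} (hx : x ∈ (chartAt E q).source) :
    HasMFDerivAt 𝓘(ℝ, E) 𝓘(ℝ, E) (extChartAt 𝓘(ℝ, E) q).symm (extChartAt 𝓘(ℝ, E) q x)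
      (chartSymmDeriv (E := E) q x) := by
  have hmem : extChartAt 𝓘(ℝ, E) q x ∈ (extChartAt 𝓘(ℝ, E) q).target :=
    (extChartAt 𝓘(ℝ, E) q).map_source (by rwa [extChartAt_source])
  have hderiv : chartSymmDeriv (E := E) q x = mfderiv 𝓘(ℝ, E) 𝓘(ℝ, E)
      (extChartAt 𝓘(ℝ, E) q).symm (extChartAt 𝓘(ℝ, E) q x) := by
    rw [← mfderivWithin_univ, ← 𝓘(ℝ, E).range_eq_univ]
    exact TangentBundle.symmL_trivializationAt hx
  rw [hderiv]
  exact (mdifferentiableAt_extChartAt_symm hmem).hasMFDerivAt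

theorem chartSymmDeriv_self (q : Q) : chartSymmDeriv (E := E) q q = .id ℝ E :=
  (TangentBundle.symmL_trivializationAt (mem_chart_source E q)).trans
    mfderivWithin_range_extChartAt_symm

theorem extChartAt_cotangentBundle_apply (q x : CotangentBundle E Q) :
    extChartAt (cotangentModel E) q x = (extChartAt 𝓘(ℝ, E) q.proj x.proj,
      (covector x).comp (chartSymmDeriv q.proj x.proj)) := by
  refine Prod.ext rfl ?_
  change (trivializationAt (E →L[ℝ] ℝ)
    (fun q : Q => TangentSpace 𝓘(ℝ, E) q →L[ℝ] ℝ) q.proj x).2 = _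
  rw [hom_trivializationAt_apply]
  ext v
  simp [ContinuousLinearMap.inCoordinates, covector, chartSymmDeriv]
  rfl

theorem extChartAt_extCotangent_apply (p x : CotangentBundle E Q × ℝ) :
    extChartAt (extCotangentModel E) p x = ((extChartAt 𝓘(ℝ, E) p.1.proj x.1.proj,
      (covector x.1).comp (chartSymmDeriv p.1.proj x.1.proj)), x.2) :=
  Prod.ext (extChartAt_cotangentBundle_apply p.1 x.1) rfl

theorem extChartAt_extCotangent_self (p : CotangentBundle E Q × ℝ) :
    extChartAt (extCotangentModel E) p p =
      ((extChartAt 𝓘(ℝ, E) p.1.proj p.1.proj, covector p.1), p.2) := by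
  rw [extChartAt_extCotangent_apply, chartSymmDeriv_self]
  rfl

theorem proj_mem_chartAt_source {p x : CotangentBundle E Q × ℝ}
    (hx : x ∈ (extChartAt (extCotangentModel E) p).source) :
    x.1.proj ∈ (chartAt E p.1.proj).source := by
  rw [extChartAt_source] at hx
  exact hx.1.1.1

theorem proj_extChartAt_extCotangent_symm {p : CotangentBundle E Q × ℝ} {y : ExtCotangentCoord E}
    (hy : y ∈ (extChartAt (extCotangentModel E) p).target) :
    ((extChartAt (extCotangentModel E) p).symm y).1.proj =
      (extChartAt 𝓘(ℝ, E) p.1.proj).symm y.1.1 := by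
  have hmem := proj_mem_chartAt_source ((extChartAt (extCotangentModel E) p).map_target hy)
  conv_rhs => rw [← (extChartAt (extCotangentModel E) p).right_inv hy,
    extChartAt_extCotangent_apply]
  exact ((extChartAt 𝓘(ℝ, E) p.1.proj).left_inv (by rwa [extChartAt_source])).symm

theorem hasMFDerivAt_cotangentBundle_proj (q : CotangentBundle E Q) :
    HasMFDerivAt (cotangentModel E) 𝓘(ℝ, E) (fun x : CotangentBundle E Q => x.proj) q
      (ContinuousLinearMap.fst ℝ E (E →L[ℝ] ℝ)) := by
  refine ⟨(FiberBundle.continuous_proj _ _).continuousAt, ?_⟩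
  refine (ContinuousLinearMap.hasFDerivAt _).hasFDerivWithinAt.congr_of_eventuallyEq ?_ ?_
  · filter_upwards [extChartAt_target_mem_nhdsWithin (I := cotangentModel E) q] with y hy
    have hright := congrArg Prod.fst ((extChartAt (cotangentModel E) q).right_inv hy)
    rwa [extChartAt_cotangentBundle_apply] at hright
  · simp only [writtenInExtChartAt, Function.comp, extChartAt_to_inv]
    rw [extChartAt_cotangentBundle_apply]
    rfl

theorem hasMFDerivAt_extCotangent_proj (p : CotangentBundle E Q × ℝ) :
    HasMFDerivAt (extCotangentModel E) 𝓘(ℝ, E)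
      (fun x : CotangentBundle E Q × ℝ => x.1.proj) p (baseProj (E := E)) :=
  (hasMFDerivAt_cotangentBundle_proj p.1).comp p (hasMFDerivAt_fst p)

theorem canonicalContactForm_apply (p : CotangentBundle E Q × ℝ) (v : ExtCotangentCoord E) :
    canonicalContactForm E p v = v.2 - covector p.1 v.1.1 := by
  simp only [canonicalContactForm, tautologicalForm]
  rw [(hasMFDerivAt_cotangentBundle_proj p.1).mfderiv, mfderiv_fst, mfderiv_snd]
  rfl

theorem canonicalContactForm_comp_mfderiv {V : Type*} [NormedAddCommGroup V] [NormedSpace ℝ V]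
    {f : V → CotangentBundle E Q × ℝ} {y : V} {A : V →L[ℝ] E} {B : V →L[ℝ] ℝ}
    (hf : MDifferentiableAt 𝓘(ℝ, V) (extCotangentModel E) f y)
    (hproj : HasMFDerivAt 𝓘(ℝ, V) 𝓘(ℝ, E) (fun w => (f w).1.proj) y A)
    (hsnd : HasMFDerivAt 𝓘(ℝ, V) 𝓘(ℝ, ℝ) (fun w => (f w).2) y B) :
    (canonicalContactForm E (f y)).comp (mfderiv 𝓘(ℝ, V) (extCotangentModel E) f y) =
      B - (covector (f y).1).comp A := by
  have hA := hasMFDerivAt_unique ((hasMFDerivAt_extCotangent_proj (f y)).comp y hf.hasMFDerivAt)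
    hproj
  have hB := hasMFDerivAt_unique
    ((hasMFDerivAt_snd (I := cotangentModel E) (I' := 𝓘(ℝ, ℝ)) (x := f y)).comp y hf.hasMFDerivAt)
    hsnd
  subst hA hB
  exact ContinuousLinearMap.ext fun v => canonicalContactForm_apply (f y) _

/-- The canonical contact form `dz - ξ dx` in the coordinates `((x, ξ), z)`. -/
def contactFormCoord (y : ExtCotangentCoord E) : ExtCotangentCoord E →L[ℝ] ℝ :=
  ContinuousLinearMap.snd ℝ _ _ - (fiberProj y).comp baseProj

theorem canonicalContactForm_comp_mfderiv_extChartAt_symm (p : CotangentBundle E Q × ℝ)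
    {y : ExtCotangentCoord E} (hy : y ∈ (extChartAt (extCotangentModel E) p).target) :
    (canonicalContactForm E ((extChartAt (extCotangentModel E) p).symm y)).comp
      (mfderiv 𝓘(ℝ, ExtCotangentCoord E) (extCotangentModel E)
        (extChartAt (extCotangentModel E) p).symm y) = contactFormCoord y := by
  set φ := extChartAt (extCotangentModel E) p with hφ
  set q := φ.symm y
  have hqs : q.1.proj ∈ (chartAt E p.1.proj).source := proj_mem_chartAt_source (φ.map_target hy)
  have hcoord : φ q = y := φ.right_inv hy
  rw [hφ, extChartAt_extCotangent_apply] at hcoord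
  have hx : extChartAt 𝓘(ℝ, E) p.1.proj q.1.proj = y.1.1 := congrArg (fun w => w.1.1) hcoord
  have hξ : (covector q.1).comp (chartSymmDeriv p.1.proj q.1.proj) = y.1.2 :=
    congrArg (fun w => w.1.2) hcoord
  have hproj : HasMFDerivAt 𝓘(ℝ, ExtCotangentCoord E) 𝓘(ℝ, E) (fun w => (φ.symm w).1.proj) y
      (((chartSymmDeriv p.1.proj q.1.proj).comp baseProj :
        ExtCotangentCoord E →L[ℝ] E)) := by
    have hchart := hasMFDerivAt_extChartAt_symm hqs
    rw [hx] at hchart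
    refine (hchart.comp y baseProj.hasMFDerivAt).congr_of_eventuallyEq ?_
    filter_upwards [extChartAt_target_mem_nhds' hy] with w hw
    exact proj_extChartAt_extCotangent_symm hw
  have hsnd : HasMFDerivAt 𝓘(ℝ, ExtCotangentCoord E) 𝓘(ℝ, ℝ) (fun w => (φ.symm w).2) y
      (ContinuousLinearMap.snd ℝ (E × (E →L[ℝ] ℝ)) ℝ) := by
    refine (ContinuousLinearMap.hasMFDerivAt _).congr_of_eventuallyEq ?_
    filter_upwards [extChartAt_target_mem_nhds' hy] with w hw
    exact congrArg Prod.snd (φ.right_inv hw)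
  have hsymm : MDifferentiableAt 𝓘(ℝ, ExtCotangentCoord E) (extCotangentModel E) φ.symm y :=
    mdifferentiableAt_extChartAt_symm hy
  refine (canonicalContactForm_comp_mfderiv hsymm hproj hsnd).trans ?_
  rw [contactFormCoord, show fiberProj y = _ from hξ.symm]
  rfl

theorem hasFDerivAt_const_sub_comp {V : Type*} [NormedAddCommGroup V] [NormedSpace ℝ V]
    (s : V →L[ℝ] ℝ) (a : V →L[ℝ] E →L[ℝ] ℝ) (b : V →L[ℝ] E) (y : V) :
    HasFDerivAt (fun y => s - (a y).comp b) (-((ContinuousLinearMap.precomp ℝ b).comp a)) y :=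
  ((ContinuousLinearMap.precomp ℝ b).comp a).hasFDerivAt.const_sub s

theorem extDerivOneForm_canonicalContactForm_apply (p : CotangentBundle E Q × ℝ)
    (u v : ExtCotangentCoord E) :
    extDerivOneForm (extCotangentModel E) (canonicalContactForm E) p u v =
      v.1.2 u.1.1 - u.1.2 v.1.1 := by
  have hderiv := hasFDerivAt_const_sub_comp (ContinuousLinearMap.snd ℝ (E × (E →L[ℝ] ℝ)) ℝ)
    fiberProj baseProj (extChartAt (extCotangentModel E) p p)
  refine (extDerivOneForm_apply_of_hasFDerivAt (canonicalContactForm E) p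
    (fun y => canonicalContactForm_comp_mfderiv_extChartAt_symm p) hderiv u v).trans ?_
  change -u.1.2 v.1.1 - -v.1.2 u.1.1 = _
  ring

theorem contactFlat_canonicalContactForm_apply (p : CotangentBundle E Q × ℝ)
    (u v : ExtCotangentCoord E) :
    contactFlat (extCotangentModel E) (canonicalContactForm E) p u v =
      v.1.2 u.1.1 - u.1.2 v.1.1 +
        (u.2 - covector p.1 u.1.1) * (v.2 - covector p.1 v.1.1) :=
  congrArg₂ (· + ·) (extDerivOneForm_canonicalContactForm_apply p u v)
    (congrArg₂ (· * ·) (canonicalContactForm_apply p u) (canonicalContactForm_apply p v))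

theorem contactFlat_canonicalContactForm_injective (p : CotangentBundle E Q × ℝ) :
    Function.Injective (contactFlat (extCotangentModel E) (canonicalContactForm E) p) := by
  intro u u' heq
  obtain ⟨⟨x, ξ⟩, z⟩ : ExtCotangentCoord E := u
  obtain ⟨⟨x', ξ'⟩, z'⟩ : ExtCotangentCoord E := u'
  have hflat (w : E) (β : E →L[ℝ] ℝ) (r : ℝ) :
      β x - ξ w + (z - covector p.1 x) * (r - covector p.1 w) =
        β x' - ξ' w + (z' - covector p.1 x') * (r - covector p.1 w) :=
    (contactFlat_canonicalContactForm_apply p ((x, ξ), z) ((w, β), r)).symm.trans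
      ((DFunLike.congr_fun heq ((w, β), r)).trans
        (contactFlat_canonicalContactForm_apply p ((x', ξ'), z') ((w, β), r)))
  have hx : x = x' :=
    (SeparatingDual.eq_iff_forall_dual_eq (R := ℝ)).2 fun β => by simpa using hflat 0 β 0
  subst hx
  have hz : z = z' := by simpa using hflat 0 0 1
  subst hz
  have hξ : ξ = ξ' := by
    ext w
    simpa using hflat w 0 0
  rw [hξ]

theorem reebField_canonicalContactForm (p : CotangentBundle E Q × ℝ) :
    reebField (extCotangentModel E) (canonicalContactForm E) p =
      (((0, 0), 1) : ExtCotangentCoord E) := by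
  refine reebField_eq_of_injective (contactFlat_canonicalContactForm_injective p) ?_ ?_
  · refine ContinuousLinearMap.ext fun v => ?_
    refine (extDerivOneForm_canonicalContactForm_apply p _ v).trans ?_
    simp
  · refine (canonicalContactForm_apply p _).trans ?_
    simp

end CotangentCoordinates

section LeftTranslations

variable {E : Type*} [NormedAddCommGroup E] [NormedSpace ℝ E]
  {G : Type*} [TopologicalSpace G] [ChartedSpace E G] [Group G]

/-- The derivative at `k` of the left translation by `g`, as a linear map of the model space. -/
def leftMulDeriv (g k : G) : E →L[ℝ] E :=
  mfderiv 𝓘(ℝ, E) 𝓘(ℝ, E) (fun x : G => g * x) k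

/-- The derivative at `k` of the chart around `g`, as a linear map of the model space. -/
def chartDeriv (g k : G) : E →L[ℝ] E :=
  mfderiv 𝓘(ℝ, E) 𝓘(ℝ, E) (extChartAt 𝓘(ℝ, E) g) k

/-- The left trivialization of `TG` in the chart around `g`: it maps `v` to the value, at the point
with coordinates `x`, of the left invariant vector field defined by `v`. -/
def leftFrame (g : G) (x : E) : E →L[ℝ] E :=
  (chartDeriv g ((extChartAt 𝓘(ℝ, E) g).symm x)).comp
    (leftMulDeriv ((extChartAt 𝓘(ℝ, E) g).symm x) 1)

/-- The derivative at `g` of the left trivialization of `TG` in the chart around `g`. -/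
def leftFrameDeriv (g : G) : E →L[ℝ] E →L[ℝ] E :=
  fderiv ℝ (leftFrame g) (extChartAt 𝓘(ℝ, E) g g)

theorem leftMulDeriv_one_left (k : G) : leftMulDeriv 1 k = .id ℝ E := by
  rw [leftMulDeriv, show (fun x : G => 1 * x) = id from funext one_mul]
  exact mfderiv_id

theorem leftFrame_extChartAt {g k : G} (hk : k ∈ (chartAt E g).source) :
    leftFrame g (extChartAt 𝓘(ℝ, E) g k) = (chartDeriv g k).comp (leftMulDeriv k 1) := by
  rw [leftFrame, (extChartAt 𝓘(ℝ, E) g).left_inv (by rwa [extChartAt_source])]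

variable [LieGroup 𝓘(ℝ, E) ∞ G]

theorem lieGroup_minSmoothness_three (E : Type*) [NormedAddCommGroup E] [NormedSpace ℝ E]
    (G : Type*) [TopologicalSpace G] [ChartedSpace E G] [Group G] [LieGroup 𝓘(ℝ, E) ∞ G] :
    LieGroup 𝓘(ℝ, E) (minSmoothness ℝ 3) G := by
  rw [minSmoothness_of_isRCLikeNormedField]
  exact LieGroup.of_le (n := ∞) ENat.LEInfty.out

theorem hasMFDerivAt_mul_left (g k : G) :
    HasMFDerivAt 𝓘(ℝ, E) 𝓘(ℝ, E) (fun x : G => g * x) k (leftMulDeriv (E := E) g k) :=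
  ((contMDiff_mul_left (I := 𝓘(ℝ, E)) (n := ∞)).mdifferentiable (by simp) k).hasMFDerivAt

theorem leftMulDeriv_mul (g h k : G) :
    leftMulDeriv (E := E) (g * h) k = (leftMulDeriv g (h * k)).comp (leftMulDeriv h k) := by
  have hcomp := (hasMFDerivAt_mul_left (E := E) g (h * k)).comp k (hasMFDerivAt_mul_left h k)
  refine hasMFDerivAt_unique (hasMFDerivAt_mul_left (g * h) k) (hcomp.congr_of_eventuallyEq ?_)
  exact .of_forall fun x => mul_assoc g h x

theorem leftMulDeriv_inv_comp (k : G) :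
    (leftMulDeriv k⁻¹ k).comp (leftMulDeriv k 1) = .id ℝ E := by
  have hmul := leftMulDeriv_mul (E := E) k⁻¹ k 1
  rwa [inv_mul_cancel, leftMulDeriv_one_left, mul_one, eq_comm] at hmul

theorem leftMulDeriv_comp_inv (k : G) :
    (leftMulDeriv k 1).comp (leftMulDeriv k⁻¹ k) = .id ℝ E := by
  have hmul := leftMulDeriv_mul (E := E) k k⁻¹ k
  rwa [mul_inv_cancel, leftMulDeriv_one_left, inv_mul_cancel, eq_comm] at hmul

theorem chartDeriv_comp_chartSymmDeriv {g k : G} (hk : k ∈ (chartAt E g).source) :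
    (chartDeriv g k).comp (chartSymmDeriv g k) = .id ℝ E := by
  rw [chartSymmDeriv, TangentBundle.symmL_trivializationAt hk]
  exact mfderiv_extChartAt_comp_mfderivWithin_extChartAt_symm' (by rwa [extChartAt_source])

theorem chartSymmDeriv_comp_chartDeriv {g k : G} (hk : k ∈ (chartAt E g).source) :
    (chartSymmDeriv g k).comp (chartDeriv g k) = .id ℝ E := by
  rw [chartSymmDeriv, TangentBundle.symmL_trivializationAt hk]
  exact mfderivWithin_extChartAt_symm_comp_mfderiv_extChartAt' (by rwa [extChartAt_source])

theorem chartSymmDeriv_comp_leftFrame {g k : G} (hk : k ∈ (chartAt E g).source) :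
    (chartSymmDeriv g k).comp (leftFrame g (extChartAt 𝓘(ℝ, E) g k)) = leftMulDeriv k 1 := by
  rw [leftFrame_extChartAt hk, ← ContinuousLinearMap.comp_assoc, chartSymmDeriv_comp_chartDeriv hk,
    ContinuousLinearMap.id_comp]

theorem leftFrame_extChartAt_self (g : G) :
    leftFrame g (extChartAt 𝓘(ℝ, E) g g) = leftMulDeriv g 1 := by
  rw [leftFrame_extChartAt (mem_chart_source E g), chartDeriv, mfderiv_extChartAt_self]
  exact ContinuousLinearMap.id_comp _

theorem mpullbackWithin_mulInvariantVectorField {g : G} {x : E}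
    (hx : x ∈ (extChartAt 𝓘(ℝ, E) g).target) (v : E) :
    VectorField.mpullbackWithin 𝓘(ℝ, E) 𝓘(ℝ, E) (extChartAt 𝓘(ℝ, E) g).symm
      (mulInvariantVectorField (I := 𝓘(ℝ, E)) (G := G) v) (range 𝓘(ℝ, E)) x =
      leftFrame g x v := by
  rw [VectorField.mpullbackWithin_apply, ContinuousLinearMap.inverse_eq
    (mfderivWithin_extChartAt_symm_comp_mfderiv_extChartAt hx)
    (mfderiv_extChartAt_comp_mfderivWithin_extChartAt_symm hx)]
  rfl

variable [FiniteDimensional ℝ E]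

theorem contDiffOn_leftFrame (g : G) :
    ContDiffOn ℝ 2 (leftFrame g) (extChartAt 𝓘(ℝ, E) g).target := by
  have := lieGroup_minSmoothness_three E G
  refine contDiffOn_clm_apply.2 fun v => contMDiffOn_iff_contDiffOn.1 ?_
  have hfield := contMDiff_mulInvariantVectorField (I := 𝓘(ℝ, E)) (G := G) v
  simp only [minSmoothness_of_isRCLikeNormedField] at hfield
  have hcoord := ((trivializationAt E (TangentSpace 𝓘(ℝ, E)) g).contMDiffOn_section_baseSet_iff
    (IB := 𝓘(ℝ, E))).1 hfield.contMDiffOn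
  have hsource : ∀ x ∈ (extChartAt 𝓘(ℝ, E) g).target,
      (extChartAt 𝓘(ℝ, E) g).symm x ∈ (chartAt E g).source := fun x hx => by
    simpa only [extChartAt_source] using (extChartAt 𝓘(ℝ, E) g).map_target hx
  refine (hcoord.comp ((contMDiffOn_extChartAt_symm (n := ∞) g).of_le ENat.LEInfty.out)
    hsource).congr fun x hx => ?_
  have htriv := TangentBundle.continuousLinearMapAt_trivializationAt (I := 𝓘(ℝ, E)) (hsource x hx)
  refine (DFunLike.congr_fun htriv (mulInvariantVectorField (I := 𝓘(ℝ, E)) v _)).symm.trans ?_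
  rw [Trivialization.continuousLinearMapAt_apply,
    Trivialization.coe_linearMapAt_of_mem _ (hsource x hx)]
  rfl

theorem hasFDerivAt_leftFrame (g : G) :
    HasFDerivAt (leftFrame g) (leftFrameDeriv (E := E) g) (extChartAt 𝓘(ℝ, E) g g) :=
  (((contDiffOn_leftFrame g).contDiffAt (extChartAt_target_mem_nhds g)).differentiableAt
    two_ne_zero).hasFDerivAt

theorem lieBracket_leftFrame (g : G) (v w : E) :
    VectorField.lieBracket ℝ (fun x => leftFrame g x v) (fun x => leftFrame g x w)
      (extChartAt 𝓘(ℝ, E) g g) =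
      leftFrameDeriv g (leftMulDeriv g 1 v) w - leftFrameDeriv g (leftMulDeriv g 1 w) v := by
  have hderiv (u : E) : HasFDerivAt (fun x => leftFrame g x u) ((leftFrameDeriv g).flip u)
      (extChartAt 𝓘(ℝ, E) g g) := by
    simpa using (hasFDerivAt_leftFrame g).clm_apply (hasFDerivAt_const u _)
  rw [VectorField.lieBracket, (hderiv v).fderiv, (hderiv w).fderiv, leftFrame_extChartAt_self]
  rfl

theorem mlieBracket_mulInvariantVectorField_eq (g : G) (v w : E) :
    VectorField.mlieBracket 𝓘(ℝ, E) (mulInvariantVectorField (I := 𝓘(ℝ, E)) (G := G) v)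
      (mulInvariantVectorField w) g =
      leftFrameDeriv (E := E) g (leftMulDeriv g 1 v) w -
        leftFrameDeriv g (leftMulDeriv g 1 w) v := by
  have hlie (V W : E → E) (hV : V =ᶠ[nhds (extChartAt 𝓘(ℝ, E) g g)] fun x => leftFrame g x v)
      (hW : W =ᶠ[nhds (extChartAt 𝓘(ℝ, E) g g)] fun x => leftFrame g x w) :
      VectorField.lieBracketWithin ℝ V W ((extChartAt 𝓘(ℝ, E) g).symm ⁻¹' univ ∩ range 𝓘(ℝ, E))
        (extChartAt 𝓘(ℝ, E) g g) =
        leftFrameDeriv g (leftMulDeriv g 1 v) w - leftFrameDeriv g (leftMulDeriv g 1 w) v := by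
    rw [preimage_univ, univ_inter, ModelWithCorners.range_eq_univ,
      VectorField.lieBracketWithin_univ, hV.lieBracket_vectorField_eq hW, lieBracket_leftFrame]
  have hcoord (u : E) := Filter.eventuallyEq_of_mem (extChartAt_target_mem_nhds (I := 𝓘(ℝ, E)) g)
    fun x hx => mpullbackWithin_mulInvariantVectorField hx u
  have hinv : (mfderiv 𝓘(ℝ, E) 𝓘(ℝ, E) (extChartAt 𝓘(ℝ, E) g) g).inverse = .id ℝ E := by
    rw [mfderiv_extChartAt_self]
    exact ContinuousLinearMap.inverse_id
  exact (DFunLike.congr_fun hinv _).trans (hlie _ _ (hcoord v) (hcoord w))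

/-- The bracket of left invariant vector fields on the Lie algebra `T_1 G`, as a continuous bilinear
map of the model space. -/
def lieBracketL (E : Type*) [NormedAddCommGroup E] [NormedSpace ℝ E]
    (G : Type*) [TopologicalSpace G] [ChartedSpace E G] [Group G] : E →L[ℝ] E →L[ℝ] E :=
  leftFrameDeriv (1 : G) - (leftFrameDeriv (1 : G)).flip

theorem lieBracketL_apply (v w : GroupLieAlgebra 𝓘(ℝ, E) G) :
    lieBracketL E G v w = ⁅v, w⁆ := by
  have hbracket := mlieBracket_mulInvariantVectorField_eq (E := E) (1 : G) v w
  rw [leftMulDeriv_one_left] at hbracket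
  exact hbracket.symm

theorem leftMulDeriv_lieBracketL (g : G) (v w : E) :
    leftMulDeriv g 1 (lieBracketL E G v w) =
      leftFrameDeriv g (leftMulDeriv g 1 v) w - leftFrameDeriv g (leftMulDeriv g 1 w) v := by
  have := lieGroup_minSmoothness_three E G
  have hinvariant := congrFun (mulInvariantVector_mlieBracket (I := 𝓘(ℝ, E)) (G := G) v w) g
  exact (congrArg (leftMulDeriv g 1) (lieBracketL_apply v w)).trans
    (hinvariant.trans (mlieBracket_mulInvariantVectorField_eq g v w))

end LeftTranslations

section Bidual

variable {V : Type*} [NormedAddCommGroup V] [NormedSpace ℝ V]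

theorem bidualVector_eq_of_forall {Φ : (V →L[ℝ] ℝ) → ℝ} {v : V} (hv : ∀ β, β v = Φ β) :
    bidualVector Φ = v :=
  (SeparatingDual.eq_iff_forall_dual_eq (R := ℝ)).2 fun β =>
    (Classical.epsilon_spec (p := fun v : V => ∀ β, β v = Φ β) ⟨v, hv⟩ β).trans (hv β).symm

variable [FiniteDimensional ℝ V]

theorem apply_sum_basis_coord {ι : Type*} [Fintype ι] (b : Module.Basis ι ℝ V)
    (Φ : (V →L[ℝ] ℝ) →L[ℝ] ℝ) (β : V →L[ℝ] ℝ) :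
    β (∑ i, Φ (b.coord i).toContinuousLinearMap • b i) = Φ β := by
  have hβ : β = ∑ i, β (b i) • (b.coord i).toContinuousLinearMap := by
    refine ContinuousLinearMap.coe_injective (b.ext fun j => ?_)
    classical simp [Finsupp.single_apply]
  conv_rhs => rw [hβ, map_sum]
  simp only [map_sum, map_smul, smul_eq_mul, mul_comm]

theorem bidualVector_eq_sum {ι : Type*} [Fintype ι] (b : Module.Basis ι ℝ V)
    (Φ : (V →L[ℝ] ℝ) →L[ℝ] ℝ) :
    bidualVector Φ = ∑ i, Φ (b.coord i).toContinuousLinearMap • b i :=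
  bidualVector_eq_of_forall (apply_sum_basis_coord b Φ)

theorem apply_bidualVector (Φ : (V →L[ℝ] ℝ) →L[ℝ] ℝ) (β : V →L[ℝ] ℝ) :
    β (bidualVector Φ) = Φ β := by
  rw [bidualVector_eq_sum (Module.finBasis ℝ V), apply_sum_basis_coord]

theorem apply_eq_apply_bidualVector (α : (V →L[ℝ] ℝ) × ℝ →L[ℝ] ℝ) (u : (V →L[ℝ] ℝ) × ℝ) :
    α u = u.1 (bidualVector fun ν => α (ν, 0)) + α (0, 1) * u.2 := by
  have hu : u = (u.1, 0) + u.2 • ((0 : V →L[ℝ] ℝ), (1 : ℝ)) := by simp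
  have hfst := apply_bidualVector (α.comp (.inl ℝ (V →L[ℝ] ℝ) ℝ)) u.1
  conv_lhs => rw [hu, map_add, map_smul, smul_eq_mul, mul_comm]
  exact congrArg (· + _) hfst.symm

end Bidual

section LiePoissonJacobi

variable {E : Type*} [NormedAddCommGroup E] [NormedSpace ℝ E]

/-- The functional derivative `δh/δμ` of a function on `E^* × ℝ`, as a vector of `E = E^{**}`. -/
def functionalDeriv (h : (E →L[ℝ] ℝ) × ℝ → ℝ) (x : (E →L[ℝ] ℝ) × ℝ) : E :=
  bidualVector fun ν : E →L[ℝ] ℝ => fderiv ℝ h x (ν, 0)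

variable [FiniteDimensional ℝ E]

theorem contDiff_functionalDeriv {n : WithTop ℕ∞} {h : (E →L[ℝ] ℝ) × ℝ → ℝ}
    (hh : ContDiff ℝ (n + 1) h) : ContDiff ℝ n (functionalDeriv h) := by
  let b := Module.finBasis ℝ E
  have hsum : functionalDeriv h =
      fun x => ∑ i, fderiv ℝ h x ((b.coord i).toContinuousLinearMap, 0) • b i := funext fun x =>
    bidualVector_eq_sum b ((fderiv ℝ h x).comp (.inl ℝ (E →L[ℝ] ℝ) ℝ))
  rw [hsum]
  exact ContDiff.sum fun i _ =>
    ((hh.fderiv_right le_rfl).clm_apply contDiff_const).smul contDiff_const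

variable {G : Type*} [TopologicalSpace G] [ChartedSpace E G] [Group G] [LieGroup 𝓘(ℝ, E) ∞ G]

theorem jacobiSharp_liePoissonJacobiBivector (h : DualLieAlgebra E G × ℝ → ℝ)
    (x : DualLieAlgebra E G × ℝ) :
    jacobiSharp (liePoissonJacobiBivector E G) x (fderiv ℝ h x) =
      (x.1.comp (lieBracketL E G (functionalDeriv h x)) - fderiv ℝ h x (0, 1) • x.1,
        x.1 (functionalDeriv h x)) := by
  refine bidualVector_eq_of_forall fun β => ?_
  let ξ : E := lieAlgebraPart E G β
  have hbracket := congrArg (fun v : E => x.1 v) (lieBracketL_apply (G := G)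
    (functionalDeriv (E := E) h x) ξ)
  rw [apply_eq_apply_bidualVector β]
  change x.1 (lieBracketL E G (functionalDeriv h x) ξ) - fderiv ℝ h x (0, 1) * x.1 ξ +
    β (0, 1) * x.1 (functionalDeriv h x) = _
  refine (congrArg (fun r : ℝ => r - _ + _) hbracket).trans ?_
  rw [sub_add_eq_add_sub, mul_comm (fderiv ℝ h x (0, 1)), mul_comm (β (0, 1))]
  rfl

theorem liePoissonJacobiField_eq (h : DualLieAlgebra E G × ℝ → ℝ) (x : DualLieAlgebra E G × ℝ) :
    liePoissonJacobiField E G h x =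
      (x.1.comp (lieBracketL E G (functionalDeriv h x)) - fderiv ℝ h x (0, 1) • x.1,
        x.1 (functionalDeriv h x) - h x) := by
  rw [liePoissonJacobiField, jacobiHamiltonianField, jacobiSharp_liePoissonJacobiBivector,
    liePoissonJacobiVector]
  simp only [Prod.smul_mk, smul_zero, smul_eq_mul, mul_neg, mul_one, Prod.mk_add_mk, add_zero,
    sub_eq_add_neg]
  rfl

theorem contDiff_liePoissonJacobiField {n : WithTop ℕ∞} {h : DualLieAlgebra E G × ℝ → ℝ}
    (hh : ContDiff ℝ (n + 1) h) :
    ContDiff ℝ n fun x => (liePoissonJacobiField E G h x : DualLieAlgebra E G × ℝ) := by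
  have hδ := contDiff_functionalDeriv hh
  have hbracket := (lieBracketL E G).contDiff.comp hδ
  have hz := (hh.fderiv_right le_rfl).clm_apply
    (contDiff_const (c := ((0 : E →L[ℝ] ℝ), (1 : ℝ))))
  simp only [liePoissonJacobiField_eq]
  exact ((contDiff_fst.clm_comp hbracket).sub (hz.smul contDiff_fst)).prodMk
    ((contDiff_fst.clm_apply hδ).sub (hh.of_le le_self_add))

end LiePoissonJacobi

section MomentumMap

variable {E : Type*} [NormedAddCommGroup E] [NormedSpace ℝ E]
  {G : Type*} [TopologicalSpace G] [ChartedSpace E G] [Group G]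

theorem momentumMapHat_apply (p : CotangentBundle E G × ℝ) :
    momentumMapHat E p = ((covector p.1).comp (leftMulDeriv p.1.proj 1), p.2) := rfl

theorem eq_restrictToIdentity_comp_momentumMapHat {H : CotangentBundle E G × ℝ → ℝ}
    (hinv : ∀ (g : G) (p : CotangentBundle E G × ℝ), H (cotangentLiftAction E g p) = H p) :
    H = restrictToIdentity E H ∘ momentumMapHat E := by
  funext p
  have htranslate (k k' : G) (hk : k = p.1.proj) (hk' : k' = 1) :
      ((⟨k', ((covector p.1).comp (leftMulDeriv k k') : E →L[ℝ] ℝ)⟩, p.2) :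
        CotangentBundle E G × ℝ) = (⟨1, (momentumMapHat E p).1⟩, (momentumMapHat E p).2) := by
    subst hk hk'
    rfl
  rw [← hinv p.1.proj⁻¹ p]
  exact congrArg H (htranslate _ _ (inv_inv _) (inv_mul_cancel _))

/-- The derivative of `Ĵ` at `p`, in cotangent coordinates. -/
def momentumMapHatDeriv (p : CotangentBundle E G × ℝ) :
    ExtCotangentCoord E →L[ℝ] DualLieAlgebra E G × ℝ :=
  ((ContinuousLinearMap.compL ℝ E E ℝ).flip (leftMulDeriv p.1.proj 1) ∘L fiberProj +
    ContinuousLinearMap.compL ℝ E E ℝ (covector p.1) ∘L leftFrameDeriv p.1.proj ∘L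
      baseProj).prod (ContinuousLinearMap.snd ℝ (E × (E →L[ℝ] ℝ)) ℝ)

theorem momentumMapHatDeriv_apply (p : CotangentBundle E G × ℝ) (u : ExtCotangentCoord E) :
    momentumMapHatDeriv p u = (u.1.2.comp (leftMulDeriv p.1.proj 1) +
      (covector p.1).comp (leftFrameDeriv p.1.proj u.1.1), u.2) := rfl

variable [LieGroup 𝓘(ℝ, E) ∞ G]

theorem contMDiff_fiberInclusion {n : WithTop ℕ∞} (g : G) :
    ContMDiff 𝓘(ℝ, DualLieAlgebra E G × ℝ) (extCotangentModel E) n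
      (fun x : DualLieAlgebra E G × ℝ => ((⟨g, x.1⟩, x.2) : CotangentBundle E G × ℝ)) := by
  intro x
  refine ContMDiffAt.prodMk ?_ contDiff_snd.contMDiff.contMDiffAt
  rw [contMDiffAt_totalSpace]
  refine ⟨contMDiffAt_const, ?_⟩
  have hcoord : ContDiff ℝ n (fun x : DualLieAlgebra E G × ℝ => x.1.comp (chartSymmDeriv g g)) := by
    fun_prop
  refine hcoord.contMDiff.contMDiffAt.congr_of_eventuallyEq (.of_forall fun y => ?_)
  exact congrArg Prod.snd
    (extChartAt_cotangentBundle_apply (⟨g, x.1⟩ : CotangentBundle E G) ⟨g, y.1⟩)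

theorem contDiff_restrictToIdentity {n : WithTop ℕ∞} {H : CotangentBundle E G × ℝ → ℝ}
    (hH : ContMDiff (extCotangentModel E) 𝓘(ℝ, ℝ) n H) : ContDiff ℝ n (restrictToIdentity E H) :=
  contMDiff_iff_contDiff.1 (hH.comp (contMDiff_fiberInclusion 1))

theorem eq_of_momentumMapHatDeriv_eq {p : CotangentBundle E G × ℝ} {u v : ExtCotangentCoord E}
    (hbase : u.1.1 = v.1.1) (hderiv : momentumMapHatDeriv p u = momentumMapHatDeriv p v) :
    u = v := by
  simp only [momentumMapHatDeriv_apply, hbase, Prod.mk.injEq, add_left_inj] at hderiv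
  have hfiber := congrArg (fun L : E →L[ℝ] ℝ => L.comp (leftMulDeriv p.1.proj⁻¹ p.1.proj)) hderiv.1
  simp only [ContinuousLinearMap.comp_assoc, leftMulDeriv_comp_inv,
    ContinuousLinearMap.comp_id] at hfiber
  exact Prod.ext (Prod.ext hbase hfiber) hderiv.2

variable [FiniteDimensional ℝ E]

theorem hasFDerivAt_comp_leftFrame (p : CotangentBundle E G × ℝ) :
    HasFDerivAt (fun w : ExtCotangentCoord E =>
        ((fiberProj w).comp (leftFrame p.1.proj (baseProj w)), w.2))
      (momentumMapHatDeriv p) ((extChartAt 𝓘(ℝ, E) p.1.proj p.1.proj, covector p.1), p.2) := by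
  set y : ExtCotangentCoord E := ((extChartAt 𝓘(ℝ, E) p.1.proj p.1.proj, covector p.1), p.2)
  have hframe : HasFDerivAt (leftFrame p.1.proj) (leftFrameDeriv p.1.proj) (baseProj y) :=
    hasFDerivAt_leftFrame p.1.proj
  have hcomp := hframe.comp y (baseProj (E := E)).hasFDerivAt
  refine ((fiberProj.hasFDerivAt.clm_comp hcomp).prodMk
    (ContinuousLinearMap.snd ℝ (E × (E →L[ℝ] ℝ)) ℝ).hasFDerivAt).congr_fderiv ?_
  rw [momentumMapHatDeriv, ← leftFrame_extChartAt_self, add_comm]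
  rfl

theorem hasMFDerivAt_momentumMapHat (p : CotangentBundle E G × ℝ) :
    HasMFDerivAt (extCotangentModel E) 𝓘(ℝ, DualLieAlgebra E G × ℝ) (momentumMapHat E) p
      (momentumMapHatDeriv p) := by
  have hcoord := hasFDerivAt_comp_leftFrame p
  rw [← extChartAt_extCotangent_self] at hcoord
  have hchart := (mdifferentiableAt_extChartAt (I := extCotangentModel E)
    (mem_chart_source _ p)).hasMFDerivAt
  rw [mfderiv_extChartAt_self] at hchart
  refine ((hcoord.hasMFDerivAt.comp p hchart).congr_of_eventuallyEq ?_).congr_mfderiv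
    (ContinuousLinearMap.comp_id _)
  filter_upwards [extChartAt_source_mem_nhds (I := extCotangentModel E) p] with q hq
  rw [momentumMapHat_apply, ← chartSymmDeriv_comp_leftFrame (proj_mem_chartAt_source hq),
    ← ContinuousLinearMap.comp_assoc, Function.comp, extChartAt_extCotangent_apply]
  rfl

/-- The contact Hamiltonian vector field of `h ∘ Ĵ` at `p`, in cotangent coordinates. -/
def reducedHamiltonianVector (h : DualLieAlgebra E G × ℝ → ℝ) (p : CotangentBundle E G × ℝ) :
    ExtCotangentCoord E :=
  let x := momentumMapHat E p
  let δ := functionalDeriv h x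
  ((leftMulDeriv p.1.proj 1 δ, -(covector p.1).comp ((leftFrameDeriv p.1.proj).flip δ) -
    fderiv ℝ h x (0, 1) • covector p.1), x.1 δ - h x)

theorem contactHamiltonianField_comp_momentumMapHat {h : DualLieAlgebra E G × ℝ → ℝ}
    (hh : Differentiable ℝ h) (p : CotangentBundle E G × ℝ) :
    contactHamiltonianField (extCotangentModel E) (canonicalContactForm E)
      (h ∘ momentumMapHat E) p = reducedHamiltonianVector h p := by
  let x := momentumMapHat E p
  let df : ExtCotangentCoord E →L[ℝ] ℝ := (fderiv ℝ h x).comp (momentumMapHatDeriv p)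
  have hf : HasMFDerivAt (extCotangentModel E) 𝓘(ℝ, ℝ) (h ∘ momentumMapHat E) p df :=
    (hh x).hasFDerivAt.hasMFDerivAt.comp p (hasMFDerivAt_momentumMapHat p)
  have hdf (u : ExtCotangentCoord E) : df u = (u.1.2.comp (leftMulDeriv p.1.proj 1) +
      (covector p.1).comp (leftFrameDeriv p.1.proj u.1.1)) (functionalDeriv h x) +
        fderiv ℝ h x (0, 1) * u.2 :=
    apply_eq_apply_bidualVector (fderiv ℝ h x) (momentumMapHatDeriv p u)
  refine contactHamiltonianField_eq_of_injective (contactFlat_canonicalContactForm_injective p)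
    hf ?_
  refine ContinuousLinearMap.ext fun v : ExtCotangentCoord E => ?_
  refine (contactFlat_canonicalContactForm_apply p _ v).trans ?_
  have hReeb : df (((0, 0), 1) : ExtCotangentCoord E) = fderiv ℝ h x (0, 1) := by simp [hdf]
  have hη := canonicalContactForm_apply p v
  rw [reebField_canonicalContactForm]
  refine Eq.trans ?_ (congrArg₂ (fun r s => r - (h x + df ((0, 0), 1)) * s) (hdf v) hη).symm
  rw [hReeb]
  simp only [x, reducedHamiltonianVector, momentumMapHat_apply, add_apply, sub_apply, neg_apply,
    smul_apply, ContinuousLinearMap.comp_apply, ContinuousLinearMap.flip_apply, smul_eq_mul]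
  ring

theorem momentumMapHatDeriv_reducedHamiltonianVector (h : DualLieAlgebra E G × ℝ → ℝ)
    (p : CotangentBundle E G × ℝ) :
    momentumMapHatDeriv p (reducedHamiltonianVector h p) =
      liePoissonJacobiField E G h (momentumMapHat E p) := by
  rw [liePoissonJacobiField_eq, momentumMapHatDeriv_apply]
  refine Prod.ext (ContinuousLinearMap.ext fun w => ?_) rfl
  have hbracket := congrArg (covector p.1)
    (leftMulDeriv_lieBracketL p.1.proj (functionalDeriv h (momentumMapHat E p)) w)
  rw [map_sub] at hbracket
  simp only [momentumMapHat_apply, reducedHamiltonianVector, ContinuousLinearMap.comp_apply,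
    ContinuousLinearMap.sub_comp, ContinuousLinearMap.neg_comp, ContinuousLinearMap.smul_comp,
    add_apply, sub_apply, neg_apply, ContinuousLinearMap.flip_apply, smul_apply,
    smul_eq_mul] at hbracket ⊢
  linear_combination -hbracket

theorem fieldsRelated_momentumMapHat {h : DualLieAlgebra E G × ℝ → ℝ} (hh : Differentiable ℝ h) :
    FieldsRelated (I := extCotangentModel E) (I' := 𝓘(ℝ, DualLieAlgebra E G × ℝ))
      (momentumMapHat E)
      (contactHamiltonianField (extCotangentModel E) (canonicalContactForm E)
        (h ∘ momentumMapHat E))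
      (liePoissonJacobiField E G h) := by
  refine fun p => ⟨(hasMFDerivAt_momentumMapHat p).mdifferentiableAt, ?_⟩
  rw [(hasMFDerivAt_momentumMapHat p).mfderiv, contactHamiltonianField_comp_momentumMapHat hh]
  exact momentumMapHatDeriv_reducedHamiltonianVector h p

theorem eq_contactHamiltonianField_comp_momentumMapHat {h : DualLieAlgebra E G × ℝ → ℝ}
    (hh : Differentiable ℝ h) {p : CotangentBundle E G × ℝ} {u : ExtCotangentCoord E}
    (hbase : u.1.1 = leftMulDeriv p.1.proj 1 (functionalDeriv h (momentumMapHat E p)))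
    (hderiv : momentumMapHatDeriv p u = liePoissonJacobiField E G h (momentumMapHat E p)) :
    u = contactHamiltonianField (extCotangentModel E) (canonicalContactForm E)
      (h ∘ momentumMapHat E) p := by
  rw [contactHamiltonianField_comp_momentumMapHat hh]
  exact eq_of_momentumMapHatDeriv_eq hbase
    (hderiv.trans (momentumMapHatDeriv_reducedHamiltonianVector h p).symm)

end MomentumMap

section IntegralCurves

variable {V : Type*} [NormedAddCommGroup V] [NormedSpace ℝ V]

theorem contDiffOn_of_isMIntegralCurveOn {X : V → V} (hX : Continuous X) {c : ℝ → V} {S : Set ℝ}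
    (hS : IsOpen S) (hc : IsMIntegralCurveOn (I := 𝓘(ℝ, V)) c X S) : ContDiffOn ℝ 1 c S := by
  have hderiv : ∀ s ∈ S, HasDerivAt c (X (c s)) s := fun s hs => by
    have hfderiv : HasFDerivAt c ((1 : ℝ →L[ℝ] ℝ).smulRight (X (c s))) s :=
      ((hc s hs).hasMFDerivAt (hS.mem_nhds hs)).hasFDerivAt
    simpa using hfderiv.hasDerivAt
  rw [← zero_add (1 : WithTop ℕ∞), contDiffOn_succ_iff_deriv_of_isOpen hS, contDiffOn_zero]
  refine ⟨fun s hs => (hderiv s hs).differentiableAt.differentiableWithinAt, by simp, ?_⟩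
  have hcont : ContinuousOn c S := fun s hs => (hderiv s hs).continuousAt.continuousWithinAt
  exact (hX.comp_continuousOn hcont).congr fun s hs => (hderiv s hs).deriv

theorem exists_eventually_hasDerivAt_of_contDiffAt [CompleteSpace V] {f : V × ℝ → V} {x : V}
    {s : ℝ} (hf : ContDiffAt ℝ 1 f (x, s)) :
    ∃ y : ℝ → V, y s = x ∧ ∀ᶠ t in nhds s, HasDerivAt y (f (y t, t)) t := by
  obtain ⟨α, hαs, ε, hε, hα⟩ := (hf.prodMk (contDiffAt_const (c := (1 : ℝ))))
    |>.exists_forall_mem_closedBall_exists_eq_forall_mem_Ioo_hasDerivAt₀ s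
  have hs : s ∈ Ioo (s - ε) (s + ε) := ⟨by linarith, by linarith⟩
  have hsnd (t : ℝ) (ht : t ∈ Ioo (s - ε) (s + ε)) : HasDerivAt (fun t => (α t).2) 1 t :=
    (ContinuousLinearMap.snd ℝ V ℝ).hasFDerivAt.comp_hasDerivAt t (hα t ht)
  have htime : EqOn (fun t => (α t).2) id (Ioo (s - ε) (s + ε)) :=
    isOpen_Ioo.eqOn_of_deriv_eq isPreconnected_Ioo
      (fun t ht => (hsnd t ht).differentiableAt.differentiableWithinAt) differentiableOn_id
      (fun t ht => (hsnd t ht).deriv.trans (deriv_id t).symm) hs (congrArg Prod.snd hαs)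
  refine ⟨fun t => (α t).1, congrArg Prod.fst hαs, ?_⟩
  filter_upwards [isOpen_Ioo.mem_nhds hs] with t ht
  have hfst := (ContinuousLinearMap.fst ℝ V ℝ).hasFDerivAt.comp_hasDerivAt t (hα t ht)
  rwa [show α t = ((α t).1, t) from Prod.ext rfl (htime ht)] at hfst

end IntegralCurves

section LeftVelocity

variable {E : Type*} [NormedAddCommGroup E] [NormedSpace ℝ E]
  {G : Type*} [TopologicalSpace G] [ChartedSpace E G] [Group G]

/-- At time `t`, the curve `k` in the group has velocity the left translate by `k t` of the vector
`v` of the Lie algebra. -/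
def HasLeftVelocity (k : ℝ → G) (v : E) (t : ℝ) : Prop :=
  HasMFDerivAt 𝓘(ℝ, ℝ) 𝓘(ℝ, E) k t
    ((1 : ℝ →L[ℝ] ℝ).smulRight (leftMulDeriv (k t) 1 v) : ℝ →L[ℝ] E)

variable {k l : ℝ → G} {v : E} {s t : ℝ}

theorem HasLeftVelocity.congr_of_eventuallyEq (hk : HasLeftVelocity k v t)
    (hl : l =ᶠ[nhds t] k) : HasLeftVelocity l v t := by
  rw [HasLeftVelocity, hl.eq_of_nhds]
  exact HasMFDerivAt.congr_of_eventuallyEq hk hl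

theorem HasLeftVelocity.ite_le (hkl : k s = l s) (hk : t ≤ s → HasLeftVelocity k v t)
    (hl : s ≤ t → HasLeftVelocity l v t) :
    HasLeftVelocity (fun r => if r ≤ s then k r else l r) v t := by
  rcases lt_trichotomy t s with hts | rfl | hst
  · refine (hk hts.le).congr_of_eventuallyEq ?_
    filter_upwards [Iic_mem_nhds hts] with r hr using if_pos hr
  · have hleft : EqOn (fun r => if r ≤ t then k r else l r) k (Iic t) := fun r hr => if_pos hr
    have hright : EqOn (fun r => if r ≤ t then k r else l r) l (Ici t) := fun r hr => by
      rcases (mem_Ici.1 hr).eq_or_lt with rfl | hr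
      · exact (if_pos le_rfl).trans hkl
      · exact if_neg hr.not_ge
    have hl' := hl le_rfl
    rw [HasLeftVelocity, ← hkl] at hl'
    rw [HasLeftVelocity, if_pos le_rfl]
    exact hasMFDerivWithinAt_univ.1 (Iic_union_Ici (a := t) ▸
      ((hk le_rfl).hasMFDerivWithinAt.congr_mono hleft (hleft self_mem_Iic) subset_rfl).union
        (hl'.hasMFDerivWithinAt.congr_mono hright (hright self_mem_Ici) subset_rfl))
  · refine (hl hst.le).congr_of_eventuallyEq ?_
    filter_upwards [Ioi_mem_nhds hst] with r hr using if_neg (not_le.2 hr)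

variable [LieGroup 𝓘(ℝ, E) ∞ G]

theorem HasLeftVelocity.mul_left (hk : HasLeftVelocity k v t) (g : G) :
    HasLeftVelocity (fun s => g * k s) v t := by
  refine ((hasMFDerivAt_mul_left g (k t)).comp t hk).congr_mfderiv ?_
  rw [leftMulDeriv_mul, mul_one]
  refine ContinuousLinearMap.ext_ring ?_
  change leftMulDeriv g (k t) ((1 : ℝ) • leftMulDeriv (k t) 1 v) =
    (1 : ℝ) • leftMulDeriv g (k t) (leftMulDeriv (k t) 1 v)
  rw [one_smul, one_smul]

theorem hasLeftVelocity_extChartAt_symm {g : G} {y : ℝ → E}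
    (ht : y t ∈ (extChartAt 𝓘(ℝ, E) g).target) (hy : HasDerivAt y (leftFrame g (y t) v) t) :
    HasLeftVelocity (fun s => (extChartAt 𝓘(ℝ, E) g).symm (y s)) v t := by
  have hsource : (extChartAt 𝓘(ℝ, E) g).symm (y t) ∈ (chartAt E g).source := by
    simpa only [extChartAt_source] using (extChartAt 𝓘(ℝ, E) g).map_target ht
  have hsymm := hasMFDerivAt_extChartAt_symm (E := E) hsource
  have hframe := chartSymmDeriv_comp_leftFrame hsource
  rw [(extChartAt 𝓘(ℝ, E) g).right_inv ht] at hsymm hframe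
  refine (hsymm.comp t hy.hasFDerivAt.hasMFDerivAt).congr_mfderiv ?_
  rw [← hframe]
  refine ContinuousLinearMap.ext_ring ?_
  change chartSymmDeriv g _ ((1 : ℝ) • leftFrame g (y t) v) =
    (1 : ℝ) • chartSymmDeriv g _ (leftFrame g (y t) v)
  rw [one_smul, one_smul]

variable {ζ : ℝ → E}

theorem exists_hasLeftVelocity_Ioo_union {k k' : ℝ → G} {a b a' b' : ℝ} (hs : s ∈ Ioo a b)
    (hs' : s ∈ Ioo a' b') (hk : ∀ t ∈ Ioo a b, HasLeftVelocity k (ζ t) t)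
    (hk' : ∀ t ∈ Ioo a' b', HasLeftVelocity k' (ζ t) t) :
    ∃ l : ℝ → G, ∀ t ∈ Ioo (min a a') (max b b'), HasLeftVelocity l (ζ t) t := by
  obtain ⟨k₁, hk₁⟩ : ∃ k₁ : ℝ → G, ∀ t ∈ Ioc (min a a') s, HasLeftVelocity k₁ (ζ t) t := by
    rcases min_choice a a' with hmin | hmin <;> rw [hmin]
    · exact ⟨k, fun t ht => hk t ⟨ht.1, ht.2.trans_lt hs.2⟩⟩
    · exact ⟨k', fun t ht => hk' t ⟨ht.1, ht.2.trans_lt hs'.2⟩⟩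
  obtain ⟨k₂, hk₂⟩ : ∃ k₂ : ℝ → G, ∀ t ∈ Ico s (max b b'), HasLeftVelocity k₂ (ζ t) t := by
    rcases max_choice b b' with hmax | hmax <;> rw [hmax]
    · exact ⟨k, fun t ht => hk t ⟨hs.1.trans_le ht.1, ht.2⟩⟩
    · exact ⟨k', fun t ht => hk' t ⟨hs'.1.trans_le ht.1, ht.2⟩⟩
  refine ⟨fun r => if r ≤ s then k₁ r else k₁ s * (k₂ s)⁻¹ * k₂ r, fun t ht => ?_⟩
  exact .ite_le (inv_mul_cancel_right _ _).symm (fun hts => hk₁ t ⟨ht.1, hts⟩)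
    fun hst => (hk₂ t ⟨hst, ht.2⟩).mul_left _

theorem exists_hasLeftVelocity_Ioo_of_eventually {S : Set ℝ} (hS : IsPreconnected S)
    (hlocal : ∀ s ∈ S, ∃ k : ℝ → G, ∀ᶠ t in nhds s, HasLeftVelocity k (ζ t) t)
    (hs : s ∈ S) (ht : t ∈ S) :
    ∃ (k : ℝ → G) (a b : ℝ), s ∈ Ioo a b ∧ t ∈ Ioo a b ∧
      ∀ r ∈ Ioo a b, HasLeftVelocity k (ζ r) r := by
  refine hS.induction₂ (fun s t => ∃ (k : ℝ → G) (a b : ℝ), s ∈ Ioo a b ∧ t ∈ Ioo a b ∧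
      ∀ r ∈ Ioo a b, HasLeftVelocity k (ζ r) r) ?_ ?_ ?_ hs ht
  · intro x hx
    obtain ⟨k, hk⟩ := hlocal x hx
    obtain ⟨a, b, hxab, hk⟩ := mem_nhds_iff_exists_Ioo_subset.1 hk
    filter_upwards [mem_nhdsWithin_of_mem_nhds (Ioo_mem_nhds hxab.1 hxab.2)] with y hy
    exact ⟨k, a, b, hxab, hy, hk⟩
  · rintro x y z - - - ⟨k, a, b, hx, hy, hk⟩ ⟨k', a', b', hy', hz, hk'⟩
    obtain ⟨l, hl⟩ := exists_hasLeftVelocity_Ioo_union hy hy' hk hk'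
    exact ⟨l, _, _, Ioo_subset_Ioo (min_le_left _ _) (le_max_left _ _) hx,
      Ioo_subset_Ioo (min_le_right _ _) (le_max_right _ _) hz, hl⟩
  · rintro x y - - ⟨k, a, b, hx, hy, hk⟩
    exact ⟨k, a, b, hy, hx, hk⟩

variable [FiniteDimensional ℝ E]

theorem exists_eventually_hasLeftVelocity (hζ : ContDiffAt ℝ 1 ζ s) :
    ∃ k : ℝ → G, ∀ᶠ t in nhds s, HasLeftVelocity k (ζ t) t := by
  let φ := extChartAt 𝓘(ℝ, E) (1 : G)
  have hframe : ContDiffAt ℝ 1 (leftFrame (1 : G)) (φ 1) :=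
    ((contDiffOn_leftFrame 1).contDiffAt (extChartAt_target_mem_nhds 1)).of_le one_le_two
  have hode : ContDiffAt ℝ 1 (fun w : E × ℝ => leftFrame (1 : G) w.1 (ζ w.2)) (φ 1, s) :=
    (hframe.comp (φ 1, s) contDiffAt_fst).clm_apply (hζ.comp (φ 1, s) contDiffAt_snd)
  obtain ⟨y, hys, hy⟩ := exists_eventually_hasDerivAt_of_contDiffAt hode
  have htarget : ∀ᶠ t in nhds s, y t ∈ φ.target :=
    hy.self_of_nhds.continuousAt.eventually_mem (hys ▸ extChartAt_target_mem_nhds 1)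
  refine ⟨fun t => φ.symm (y t), ?_⟩
  filter_upwards [hy, htarget] with t hyt ht using hasLeftVelocity_extChartAt_symm ht hyt

theorem exists_hasLeftVelocity_Ioo {S : Set ℝ} (hS : IsPreconnected S)
    (hζ : ∀ s ∈ S, ContDiffAt ℝ 1 ζ s) (hs : s ∈ S) (ht : t ∈ S) (g : G) :
    ∃ (k : ℝ → G) (a b : ℝ), s ∈ Ioo a b ∧ t ∈ Ioo a b ∧ k s = g ∧
      ∀ r ∈ Ioo a b, HasLeftVelocity k (ζ r) r := by
  obtain ⟨k, a, b, hsab, htab, hk⟩ := exists_hasLeftVelocity_Ioo_of_eventually hS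
    (fun s hs => exists_eventually_hasLeftVelocity (G := G) (hζ s hs)) hs ht
  exact ⟨fun r => g * (k s)⁻¹ * k r, a, b, hsab, htab, inv_mul_cancel_right _ _,
    fun r hr => (hk r hr).mul_left _⟩

end LeftVelocity

section Lift

variable {E : Type*} [NormedAddCommGroup E] [NormedSpace ℝ E]
  {G : Type*} [TopologicalSpace G] [ChartedSpace E G] [Group G] [LieGroup 𝓘(ℝ, E) ∞ G]

/-- The inverse of the left trivialization `T^*G × ℝ ≃ G × (𝔤^* × ℝ)`: the point over `g` whose
image under `Ĵ` is `x`. -/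
def ofLeftTrivialization (g : G) (x : DualLieAlgebra E G × ℝ) : CotangentBundle E G × ℝ :=
  (⟨g, (x.1.comp (leftMulDeriv g⁻¹ g) : E →L[ℝ] ℝ)⟩, x.2)

theorem momentumMapHat_ofLeftTrivialization (g : G) (x : DualLieAlgebra E G × ℝ) :
    momentumMapHat E (ofLeftTrivialization g x) = x := by
  refine Prod.ext ?_ rfl
  change (x.1.comp (leftMulDeriv g⁻¹ g)).comp (leftMulDeriv g 1) = x.1
  rw [ContinuousLinearMap.comp_assoc, leftMulDeriv_inv_comp, ContinuousLinearMap.comp_id]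

theorem ofLeftTrivialization_momentumMapHat (p : CotangentBundle E G × ℝ) :
    ofLeftTrivialization p.1.proj (momentumMapHat E p) = p := by
  have hcovector : ((covector p.1).comp (leftMulDeriv p.1.proj 1)).comp
      (leftMulDeriv p.1.proj⁻¹ p.1.proj) = covector p.1 := by
    rw [ContinuousLinearMap.comp_assoc, leftMulDeriv_comp_inv, ContinuousLinearMap.comp_id]
  exact congrArg (fun α : E →L[ℝ] ℝ => ((⟨p.1.proj, α⟩, p.2) : CotangentBundle E G × ℝ)) hcovector

theorem inverse_leftFrame_extChartAt {g k : G} (hk : k ∈ (chartAt E g).source) :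
    (leftFrame g (extChartAt 𝓘(ℝ, E) g k)).inverse =
      (leftMulDeriv k⁻¹ k).comp (chartSymmDeriv g k) := by
  rw [leftFrame_extChartAt hk]
  refine ContinuousLinearMap.inverse_eq ?_ ?_
  · rw [ContinuousLinearMap.comp_assoc, ← ContinuousLinearMap.comp_assoc (leftMulDeriv k 1),
      leftMulDeriv_comp_inv, ContinuousLinearMap.id_comp, chartDeriv_comp_chartSymmDeriv hk]
  · rw [ContinuousLinearMap.comp_assoc, ← ContinuousLinearMap.comp_assoc (chartSymmDeriv g k),
      chartSymmDeriv_comp_chartDeriv hk, ContinuousLinearMap.id_comp, leftMulDeriv_inv_comp]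

variable [FiniteDimensional ℝ E]

theorem differentiableAt_inverse_leftFrame (g : G) :
    DifferentiableAt ℝ (fun x => (leftFrame g x).inverse) (extChartAt 𝓘(ℝ, E) g g) := by
  let e : E ≃L[ℝ] E := .equivOfInverse' (leftMulDeriv g 1) (leftMulDeriv g⁻¹ g)
    (leftMulDeriv_comp_inv g) (leftMulDeriv_inv_comp g)
  have hinverse : DifferentiableAt ℝ (ContinuousLinearMap.inverse (R := ℝ) (M := E) (M₂ := E))
      (leftFrame g (extChartAt 𝓘(ℝ, E) g g)) := by
    rw [leftFrame_extChartAt_self]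
    exact (contDiffAt_map_inverse (n := 1) e).differentiableAt one_ne_zero
  exact hinverse.comp _ (hasFDerivAt_leftFrame g).differentiableAt

variable {k : ℝ → G} {c : ℝ → DualLieAlgebra E G × ℝ} {t : ℝ}

theorem mdifferentiableAt_ofLeftTrivialization (hk : MDifferentiableAt 𝓘(ℝ, ℝ) 𝓘(ℝ, E) k t)
    (hc : DifferentiableAt ℝ c t) :
    MDifferentiableAt 𝓘(ℝ, ℝ) (extCotangentModel E) (fun s => ofLeftTrivialization (k s) (c s))
      t := by
  refine MDifferentiableAt.prodMk ?_ hc.snd.mdifferentiableAt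
  rw [mdifferentiableAt_totalSpace]
  refine ⟨hk, ?_⟩
  have hchart : DifferentiableAt ℝ (fun s => extChartAt 𝓘(ℝ, E) (k t) (k s)) t :=
    ((mdifferentiableAt_extChartAt (mem_chart_source E (k t))).comp t hk).differentiableAt
  have hinverse : DifferentiableAt ℝ
      (fun s => (leftFrame (k t) (extChartAt 𝓘(ℝ, E) (k t) (k s))).inverse) t :=
    DifferentiableAt.comp (g := fun x => (leftFrame (k t) x).inverse) t
      (differentiableAt_inverse_leftFrame (k t)) hchart
  refine (hc.fst.clm_comp hinverse).mdifferentiableAt.congr_of_eventuallyEq ?_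
  filter_upwards [hk.continuousAt.preimage_mem_nhds (chart_source_mem_nhds E (k t))] with s hs
  refine (congrArg Prod.snd (extChartAt_cotangentBundle_apply
    (ofLeftTrivialization (k t) (c t)).1 (ofLeftTrivialization (k s) (c s)).1)).trans ?_
  change ((c s).1.comp (leftMulDeriv (k s)⁻¹ (k s))).comp (chartSymmDeriv (k t) (k s)) = _
  rw [inverse_leftFrame_extChartAt hs, ContinuousLinearMap.comp_assoc]

variable {h : DualLieAlgebra E G × ℝ → ℝ}

theorem hasMFDerivAt_ofLeftTrivialization (hh : Differentiable ℝ h)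
    (hk : HasLeftVelocity k (functionalDeriv h (c t)) t)
    (hc : HasMFDerivAt 𝓘(ℝ, ℝ) 𝓘(ℝ, DualLieAlgebra E G × ℝ) c t
      ((1 : ℝ →L[ℝ] ℝ).smulRight (liePoissonJacobiField E G h (c t)))) :
    HasMFDerivAt 𝓘(ℝ, ℝ) (extCotangentModel E) (fun s => ofLeftTrivialization (k s) (c s)) t
      ((1 : ℝ →L[ℝ] ℝ).smulRight (contactHamiltonianField (extCotangentModel E)
        (canonicalContactForm E) (h ∘ momentumMapHat E) (ofLeftTrivialization (k t) (c t)))) := by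
  have hγ := (mdifferentiableAt_ofLeftTrivialization hk.mdifferentiableAt
    hc.mdifferentiableAt.differentiableAt).hasMFDerivAt
  set γ : ℝ → CotangentBundle E G × ℝ := fun s => ofLeftTrivialization (k s) (c s)
  obtain ⟨D, hD⟩ : ∃ D : ℝ →L[ℝ] ExtCotangentCoord E,
    mfderiv 𝓘(ℝ, ℝ) (extCotangentModel E) γ t = D := ⟨_, rfl⟩
  rw [hD] at hγ
  have hJ (s : ℝ) : momentumMapHat E (γ s) = c s := momentumMapHat_ofLeftTrivialization _ _
  have hbase : (D 1).1.1 = leftMulDeriv (k t) 1 (functionalDeriv h (c t)) :=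
    (DFunLike.congr_fun (hasMFDerivAt_unique
      ((hasMFDerivAt_extCotangent_proj (γ t)).comp t hγ) hk) (1 : ℝ)).trans (one_smul ℝ _)
  have hderiv : momentumMapHatDeriv (γ t) (D 1) = liePoissonJacobiField E G h (c t) :=
    (DFunLike.congr_fun (hasMFDerivAt_unique (((hasMFDerivAt_momentumMapHat (γ t)).comp t
      hγ).congr_of_eventuallyEq (.of_forall fun s => (hJ s).symm))
        hc) (1 : ℝ)).trans (one_smul ℝ _)
  rw [← hJ t] at hbase hderiv
  have hX := eq_contactHamiltonianField_comp_momentumMapHat hh hbase hderiv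
  refine hγ.congr_mfderiv (ContinuousLinearMap.ext_ring ?_)
  exact hX.trans (one_smul ℝ _).symm

theorem exists_isFlowCurve_contactHamiltonianField (hh : ContDiff ℝ 2 h)
    {p : CotangentBundle E G × ℝ}
    (hc : IsFlowCurve (liePoissonJacobiField E G h) t (momentumMapHat E p) c) :
    ∃ γ, IsFlowCurve (contactHamiltonianField (extCotangentModel E) (canonicalContactForm E)
      (h ∘ momentumMapHat E)) t p γ := by
  obtain ⟨a, b, h0, ht, hp, hc⟩ := hc
  have hcsmooth : ContDiffOn ℝ 1 c (Ioo a b) :=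
    contDiffOn_of_isMIntegralCurveOn (contDiff_liePoissonJacobiField (n := 1) hh).continuous
      isOpen_Ioo hc
  have hζ (s : ℝ) (hs : s ∈ Ioo a b) : ContDiffAt ℝ 1 (fun r => functionalDeriv h (c r)) s :=
    (contDiff_functionalDeriv (n := 1) hh).contDiffAt.comp s
      (hcsmooth.contDiffAt (isOpen_Ioo.mem_nhds hs))
  obtain ⟨k, a', b', h0', ht', hk0, hk⟩ :=
    exists_hasLeftVelocity_Ioo isPreconnected_Ioo hζ h0 ht p.1.proj
  have hinter : Ioo (max a a') (min b b') = Ioo a b ∩ Ioo a' b' := Ioo_inter_Ioo.symm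
  refine ⟨fun s => ofLeftTrivialization (k s) (c s), max a a', min b b', hinter ▸ ⟨h0, h0'⟩,
    hinter ▸ ⟨ht, ht'⟩, ?_, fun s hs => ?_⟩
  · simp only [hk0, hp, ofLeftTrivialization_momentumMapHat]
  · rw [hinter] at hs
    exact (hasMFDerivAt_ofLeftTrivialization (hh.differentiable two_ne_zero) (hk s hs.2)
      ((hc s hs.1).hasMFDerivAt (isOpen_Ioo.mem_nhds hs.1))).hasMFDerivWithinAt

end Lift

end

theorem mainTheorem3_general
    {E : Type*} [NormedAddCommGroup E] [NormedSpace ℝ E] [FiniteDimensional ℝ E]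
    {G : Type*} [TopologicalSpace G] [ChartedSpace E G] [Group G] [LieGroup 𝓘(ℝ, E) ∞ G]
    {n : WithTop ℕ∞} (hn : 2 ≤ n) (H : CotangentBundle E G × ℝ → ℝ)
    (hH : ContMDiff (extCotangentModel E) 𝓘(ℝ, ℝ) n H)
    (hinv : ∀ (g : G) (p : CotangentBundle E G × ℝ), H (cotangentLiftAction E g p) = H p) :
    ContDiff ℝ n (restrictToIdentity E H) ∧
    H = restrictToIdentity E H ∘ momentumMapHat E ∧
    FieldsRelated (I := extCotangentModel E) (I' := 𝓘(ℝ, DualLieAlgebra E G × ℝ))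
      (momentumMapHat E)
      (contactHamiltonianField (extCotangentModel E) (canonicalContactForm E) H)
      (liePoissonJacobiField E G (restrictToIdentity E H)) ∧
    ∀ (t : ℝ) (p : CotangentBundle E G × ℝ),
      (flow (contactHamiltonianField (extCotangentModel E) (canonicalContactForm E) H) t p).map
          (momentumMapHat E) =
        flow (liePoissonJacobiField E G (restrictToIdentity E H)) t (momentumMapHat E p) := by
  have hh : ContDiff ℝ n (restrictToIdentity E H) := contDiff_restrictToIdentity hH
  have hfactor : H = restrictToIdentity E H ∘ momentumMapHat E :=
    eq_restrictToIdentity_comp_momentumMapHat hinv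
  have hh2 : ContDiff ℝ 2 (restrictToIdentity E H) := hh.of_le hn
  have hrelated := fieldsRelated_momentumMapHat (hh2.differentiable two_ne_zero)
  rw [← hfactor] at hrelated
  have hfield : ContDiff ℝ 1 (liePoissonJacobiField E G (restrictToIdentity E H)) :=
    contDiff_liePoissonJacobiField hh2
  refine ⟨hh, hfactor, hrelated, fun t p => hrelated.map_flow_eq
    (contMDiff_vectorSpace_iff_contDiff.2 hfield) fun c hc => ?_⟩
  have hlift := exists_isFlowCurve_contactHamiltonianField hh2 hc
  rwa [← hfactor] at hlift

theorem mainTheorem3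
    {E : Type*} [NormedAddCommGroup E] [NormedSpace ℝ E] [FiniteDimensional ℝ E]
    {G : Type*} [TopologicalSpace G] [ChartedSpace E G] [Group G] [LieGroup 𝓘(ℝ, E) ∞ G]
    [T2Space G]
    (H : CotangentBundle E G × ℝ → ℝ)
    (hH : ContMDiff (extCotangentModel E) 𝓘(ℝ, ℝ) ∞ H)
    (hinv : ∀ (g : G) (p : CotangentBundle E G × ℝ), H (cotangentLiftAction E g p) = H p) :
    -- the reduced Hamiltonian is smooth, and `H = h ∘ Ĵ`
    ContDiff ℝ ∞ (restrictToIdentity E H) ∧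
    H = restrictToIdentity E H ∘ momentumMapHat E ∧
    -- the fields `X_H` and `X_h` are `Ĵ`-related
    FieldsRelated (I := extCotangentModel E) (I' := 𝓘(ℝ, DualLieAlgebra E G × ℝ))
      (momentumMapHat E)
      (contactHamiltonianField (extCotangentModel E) (canonicalContactForm E) H)
      (liePoissonJacobiField E G (restrictToIdentity E H)) ∧
    -- `Ĵ ∘ φ_t^{X_H} = φ_t^{X_h} ∘ Ĵ`, as an equality of partially defined maps
    ∀ (t : ℝ) (p : CotangentBundle E G × ℝ),
      (flow (contactHamiltonianField (extCotangentModel E) (canonicalContactForm E) H) t p).map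
          (momentumMapHat E) =
        flow (liePoissonJacobiField E G (restrictToIdentity E H)) t (momentumMapHat E p) :=
  mainTheorem3_general ENat.LEInfty.out H hH hinv
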